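/- Let $N\in\mathbb N$ and let $K:\mathbb R^N\setminus\{0\}\to(0,\infty)$ satisfy: (i) $x\mapsto\min\{|x|^2,1\}K(x)$ belongs to $L^1(\mathbb R^N)$; (ii) there are $\alpha>0$ and $s\in(0,1)$ with $2s<N$ such that $K(x)\ge\alpha|x|^{-(N+2s)}$ for all $x\ne0$; (iii) $K(-x)=K(x)$ for all $x\neq 0$. Let $\Omega\subset\mathbb R^N$ be a bounded open set (for instance, a bounded domain with Lipschitz boundary), and let $$X_K(\Omega)=\Big\{u\in L^2(\mathbb R^N):\ \|u\|^2:=\int_{\mathbb R^{2N}}(u(x)-u(y))^2K(x-y)\,dx\,dy<\infty,\ u=0\text{ a.e. in }\mathbb R^N\setminus\Omega\Big\}.$$ For $\rho\in L^\infty(\Omega)$ and an integer $k>0$ let $\mathcal F_k$ be the set of $k$-dimensional linear subspaces of $X_K(\Omega)$. Call $k$ admissible for $\rho$ if $\rho^+\not\equiv0$, and $-k$ admissible for $\rho$ if $\rho^-\not\equiv0$; here $\rho^\pm$ are the positive and negative parts of $\rho$. For admissible indices, the weighted eigenvalues of $L_Ku=\lambda\rho u$ in $\Omega$, $u=0$ in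 $\mathbb R^N\setminus\Omega$, where $L_Ku(x)=\mathrm{P.V.}\int_{\mathbb R^N}(u(x)-u(y))K(x-y)\,dy$, are given by $$\lambda_k(\rho)^{-1}=\sup_{F\in\mathcal F_k}\ \inf_{u\in F,\ \|u\|=1}\int_\Omega\rho u^2\,dx,\qquad \lambda_{-k}(\rho)^{-1}=\inf_{F\in\mathcal F_k}\ \sup_{u\in F,\ \|u\|=1}\int_\Omega\rho u^2\,dx .$$ Let $\rho_n\to\rho$ in $L^\infty(\Omega)$. Then for every $k\in\mathbb Z\setminus\{0\}$ that is admissible for $\rho$, the index $k$ is admissible for $\rho_n$ for all sufficiently large $n$, and $\lambda_k(\rho_n)\to\lambda_k(\rho)$ as $n\to\infty$. -/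

import Mathlib

open MeasureTheory Filter Topology
open scoped ENNReal

noncomputable section

namespace Nonlocal

/-- The Euclidean space `ℝ^N`. -/
abbrev Sp (N : ℕ) : Type := EuclideanSpace ℝ (Fin N)

/-- The hypotheses on the kernel `K : ℝ^N ∖ {0} → (0, ∞)`. The value `K 0` is unconstrained and
plays no role: in every integral below it is multiplied by `0`. -/
structure IsKernel (N : ℕ) (K : Sp N → ℝ) : Prop where
  pos : ∀ x, x ≠ 0 → 0 < K x
  integrable : Integrable (fun x : Sp N => min (‖x‖ ^ 2) 1 * K x) volume
  lower : ∃ α s : ℝ, 0 < α ∧ 0 < s ∧ s < 1 ∧ 2 * s < (N : ℝ) ∧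
    ∀ x, x ≠ 0 → α * ‖x‖ ^ (-((N : ℝ) + 2 * s)) ≤ K x
  symm : ∀ x, x ≠ 0 → K (-x) = K x

/-- The integrand `(u(x) - u(y)) (v(x) - v(y)) K(x - y)` at `z = (x, y)`. -/
def integrand {N : ℕ} (K : Sp N → ℝ) (u v : Sp N → ℝ) (z : Sp N × Sp N) : ℝ :=
  (u z.1 - u z.2) * (v z.1 - v z.2) * K (z.1 - z.2)

/-- The scalar product `⟨u, v⟩ = ∬ (u(x) - u(y)) (v(x) - v(y)) K(x - y) dx dy`. -/
def form {N : ℕ} (K : Sp N → ℝ) (u v : Sp N → ℝ) : ℝ :=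
  ∫ z : Sp N × Sp N, integrand K u v z

/-- The norm `‖u‖ = [u]_K = (∬ (u(x) - u(y))² K(x - y) dx dy)^{1/2}`. -/
def gnorm {N : ℕ} (K : Sp N → ℝ) (u : Sp N → ℝ) : ℝ :=
  Real.sqrt (form K u u)

theorem integrand_congr {N : ℕ} (K : Sp N → ℝ) {u v : Sp N → ℝ}
    (h : u =ᵐ[volume] v) : integrand K u u =ᵐ[volume] integrand K v v := by
  have h1 : ∀ᵐ z : Sp N × Sp N, u z.1 = v z.1 :=
    Measure.quasiMeasurePreserving_fst.ae h
  have h2 : ∀ᵐ z : Sp N × Sp N, u z.2 = v z.2 :=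
    Measure.quasiMeasurePreserving_snd.ae h
  filter_upwards [h1, h2] with z hz1 hz2
  simp only [integrand, hz1, hz2]

theorem IsKernel.aestronglyMeasurable {N : ℕ} {K : Sp N → ℝ} (hK : IsKernel N K) :
    AEStronglyMeasurable K volume := by
  obtain ⟨α, s, -, h0, -, hN, -⟩ := hK.lower
  have hN' : N ≠ 0 := by
    rintro rfl
    norm_num at hN
    linarith
  have : Nonempty (Fin N) := ⟨⟨0, Nat.pos_of_ne_zero hN'⟩⟩
  have hm : Measurable (fun x : Sp N => (min (‖x‖ ^ 2) 1)⁻¹) := by fun_prop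
  refine (hm.aestronglyMeasurable.mul hK.integrable.1).congr ?_
  have h : ∀ᵐ x : Sp N, x ≠ 0 := by
    simp [ae_iff]
  filter_upwards [h] with x hx
  have : 0 < min (‖x‖ ^ 2) 1 := lt_min (by positivity) one_pos
  simp only [Pi.mul_apply]
  field_simp

theorem IsKernel.integrand_nonneg {N : ℕ} {K : Sp N → ℝ} (hK : IsKernel N K)
    (u : Sp N → ℝ) (z : Sp N × Sp N) : 0 ≤ integrand K u u z := by
  unfold integrand
  by_cases h : z.1 = z.2
  · simp [h]
  · exact mul_nonneg (mul_self_nonneg _) (hK.pos _ (sub_ne_zero.2 h)).le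

theorem IsKernel.aestronglyMeasurable_integrand {N : ℕ} {K : Sp N → ℝ} (hK : IsKernel N K)
    {u : Sp N → ℝ} (hu : AEStronglyMeasurable u volume) :
    AEStronglyMeasurable (integrand K u u) volume := by
  have h1 : AEStronglyMeasurable (fun z : Sp N × Sp N => u z.1) volume :=
    hu.comp_quasiMeasurePreserving Measure.quasiMeasurePreserving_fst
  have h2 : AEStronglyMeasurable (fun z : Sp N × Sp N => u z.2) volume :=
    hu.comp_quasiMeasurePreserving Measure.quasiMeasurePreserving_snd
  have h3 : AEStronglyMeasurable (fun z : Sp N × Sp N => K (z.1 - z.2)) volume :=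
    hK.aestronglyMeasurable.comp_quasiMeasurePreserving
      (quasiMeasurePreserving_sub volume volume)
  exact ((h1.sub h2).mul (h1.sub h2)).mul h3

/-- The space `X_K(Ω) = {u ∈ L²(ℝ^N) : [u]_K < ∞, u = 0 a.e. in ℝ^N ∖ Ω}`. -/
def XK {N : ℕ} {K : Sp N → ℝ} (hK : IsKernel N K) (Ω : Set (Sp N)) :
    Submodule ℝ (Lp ℝ 2 (volume : Measure (Sp N))) where
  carrier := {u | Integrable (integrand K u u) volume ∧ ∀ᵐ x : Sp N, x ∉ Ω → u x = 0}
  zero_mem' := by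
    have h := Lp.coeFn_zero ℝ 2 (volume : Measure (Sp N))
    refine ⟨?_, ?_⟩
    · refine (integrable_zero _ ℝ _).congr ((integrand_congr K h).trans ?_).symm
      exact Eventually.of_forall fun z => by simp [integrand]
    · filter_upwards [h] with x hx _
      simp [hx]
  add_mem' := by
    rintro u v ⟨hu, hu0⟩ ⟨hv, hv0⟩
    have h := Lp.coeFn_add u v
    refine ⟨?_, ?_⟩
    · refine Integrable.congr ?_ (integrand_congr K h).symm
      refine ((hu.const_mul 2).add (hv.const_mul 2)).mono'
        (hK.aestronglyMeasurable_integrand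
          ((Lp.aestronglyMeasurable u).add (Lp.aestronglyMeasurable v))) ?_
      refine Eventually.of_forall fun z => ?_
      rw [Real.norm_of_nonneg (hK.integrand_nonneg _ z)]
      have hd := hK.integrand_nonneg (⇑u - ⇑v) z
      simp only [integrand, Pi.add_apply, Pi.sub_apply] at hd ⊢
      linarith
    · filter_upwards [h, hu0, hv0] with x hx h1 h2 hxΩ
      rw [hx, Pi.add_apply, h1 hxΩ, h2 hxΩ, add_zero]
  smul_mem' := by
    rintro c u ⟨hu, hu0⟩
    have h := Lp.coeFn_smul c u
    refine ⟨?_, ?_⟩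
    · refine (hu.const_mul (c ^ 2)).congr (((integrand_congr K h).trans ?_).symm)
      refine Eventually.of_forall fun z => ?_
      simp only [integrand, Pi.smul_apply, smul_eq_mul]
      ring
    · filter_upwards [h, hu0] with x hx h1 hxΩ
      rw [hx, Pi.smul_apply, h1 hxΩ, smul_zero]

/-- The space of weights `L^∞(Ω)`. -/
abbrev Weight {N : ℕ} (Ω : Set (Sp N)) : Type :=
  Lp ℝ ∞ ((volume : Measure (Sp N)).restrict Ω)

/-- The quadratic form `∫_Ω ρ u² dx`. -/
def quad {N : ℕ} {Ω : Set (Sp N)} (ρ : Weight Ω) (u : Sp N → ℝ) : ℝ :=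
  ∫ x in Ω, ρ x * u x ^ 2

/-- The linear subspaces of `X_K(Ω)` of dimension `k` (used for `k ≥ 1`). -/
abbrev Sub {N : ℕ} {K : Sp N → ℝ} (hK : IsKernel N K) (Ω : Set (Sp N)) (k : ℕ) : Type :=
  {F : Submodule ℝ (XK hK Ω) // Module.finrank ℝ F = k}

/-- The elements `u` of a subspace `F` of `X_K(Ω)` with `‖u‖ = [u]_K = 1`. -/
abbrev UnitVec {N : ℕ} {K : Sp N → ℝ} {hK : IsKernel N K} {Ω : Set (Sp N)}
    (F : Submodule ℝ (XK hK Ω)) : Type :=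
  {u : XK hK Ω // u ∈ F ∧ gnorm K u.1 = 1}

/-- The reciprocal `λ_k(ρ)⁻¹` for `k ∈ ℤ ∖ {0}`, given by the variational formulas
`λ_k⁻¹ = sup_{dim F = k} inf_{u ∈ F, ‖u‖ = 1} ∫_Ω ρ u²` and
`λ_{-k}⁻¹ = inf_{dim F = k} sup_{u ∈ F, ‖u‖ = 1} ∫_Ω ρ u²` for `k > 0`. -/
def invEigenvalue {N : ℕ} {K : Sp N → ℝ} (hK : IsKernel N K) {Ω : Set (Sp N)}
    (k : ℤ) (ρ : Weight Ω) : ℝ :=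
  if 0 < k then ⨆ F : Sub hK Ω k.natAbs, ⨅ u : UnitVec F.1, quad ρ u.1.1
  else ⨅ F : Sub hK Ω k.natAbs, ⨆ u : UnitVec F.1, quad ρ u.1.1

/-- The variational eigenvalue `λ_k(ρ)` (meaningful for admissible `k`). -/
def eigenvalue {N : ℕ} {K : Sp N → ℝ} (hK : IsKernel N K) {Ω : Set (Sp N)}
    (k : ℤ) (ρ : Weight Ω) : ℝ :=
  (invEigenvalue hK k ρ)⁻¹

/-- The index `k ∈ ℤ ∖ {0}` is admissible for `ρ`, that is, the eigenvalue `λ_k(ρ)` exists: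
`k > 0` and `ρ⁺ ≢ 0`, or `k < 0` and `ρ⁻ ≢ 0`. -/
def Admissible {N : ℕ} {Ω : Set (Sp N)} (k : ℤ) (ρ : Weight Ω) : Prop :=
  (0 < k ∧ ¬ ∀ᵐ x ∂(volume.restrict Ω), (ρ x)⁺ = 0) ∨
  (k < 0 ∧ ¬ ∀ᵐ x ∂(volume.restrict Ω), (ρ x)⁻ = 0)

end Nonlocal

end

namespace Nonlocal

variable {N : ℕ} {K : Sp N → ℝ} {Ω : Set (Sp N)}

/-! The reciprocal `λ_k⁻¹` is Lipschitz in the weight and nonzero at `ρ`, so inverting it preserves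
continuity there. The Lipschitz bound comes from a Poincaré inequality
(`exists_integral_sq_le_form`): on unit vectors of `X_K(Ω)` the forms of two weights differ by at
most `C ‖ρ - σ‖`, uniformly over all subspaces, and this survives the infimum and the supremum.
Positivity of `λ_k⁻¹` for `k > 0` needs a `k`-dimensional subspace on which `∫ ρ u²` dominates a
positive multiple of the energy (`exists_sub_form_le_quad`). The set `{ρ > 0}` meets `k` disjoint
open sets in positive measure; in each of them a Lipschitz bump has positive weighted form, and
these bumps span the subspace. Negative indices reduce to positive ones through `ρ ↦ -ρ`. -/

/-! ### Energy form and Poincaré inequality -/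

theorem IsKernel.nontrivial_sp (hK : IsKernel N K) : Nontrivial (Sp N) := by
  obtain ⟨α, s, -, h0, -, hN, -⟩ := hK.lower
  have hN' : N ≠ 0 := by
    rintro rfl
    norm_num at hN
    linarith
  have : Nonempty (Fin N) := ⟨⟨0, Nat.pos_of_ne_zero hN'⟩⟩
  infer_instance

theorem form_self_nonneg (hK : IsKernel N K) (u : Sp N → ℝ) : 0 ≤ form K u u :=
  integral_nonneg (hK.integrand_nonneg u)

theorem form_congr {u v : Sp N → ℝ} (h : u =ᵐ[volume] v) : form K u u = form K v v :=
  integral_congr_ae (integrand_congr K h)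

theorem form_eq_one_of_gnorm {u : Sp N → ℝ} (h : gnorm K u = 1) : form K u u = 1 := by
  simpa [gnorm] using h

theorem integrable_sq (u : Lp ℝ 2 (volume : Measure (Sp N))) :
    Integrable (fun x => u x ^ 2) volume :=
  (memLp_two_iff_integrable_sq (Lp.aestronglyMeasurable u)).1 (Lp.memLp u)

/-- The Poincaré inequality: the kernel is bounded below on pairs made of a point of `Ω` and a
point of a fixed ball away from `Ω`. -/
theorem exists_integral_sq_le_form (hK : IsKernel N K) (hΩb : Bornology.IsBounded Ω) :
    ∃ C : ℝ, 0 < C ∧ ∀ u : XK hK Ω, ∫ x, u.1 x ^ 2 ≤ C * form K u.1 u.1 := by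
  have := hK.nontrivial_sp
  obtain ⟨α, s, hα, hs, -, -, hlow⟩ := hK.lower
  obtain ⟨R, hR0, hR⟩ := hΩb.exists_pos_norm_lt
  obtain ⟨p, hp⟩ := NormedSpace.exists_lt_norm ℝ (Sp N) (R + 1)
  -- Since `‖p‖ > R + 1`, this ball misses `Ω`. The constant `D` bounds the distance from any point
  -- of `Ω` to any point of the ball, so `K ≥ c` on such pairs, where the integrand is `u(x)² K(x -
  -- y)`.
  set A : Set (Sp N) := Metric.ball p 1
  set D : ℝ := R + ‖p‖ + 1
  have hD : 0 < D := by positivity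
  set c : ℝ := α * D ^ (-((N : ℝ) + 2 * s))
  have hc : 0 < c := by positivity
  have hA : MeasurableSet A := measurableSet_ball
  have hvA : 0 < volume.real A := by
    refine ENNReal.toReal_pos (Metric.measure_ball_pos _ _ one_pos).ne' measure_ball_lt_top.ne
  refine ⟨(c * volume.real A)⁻¹, by positivity, fun u => ?_⟩
  rw [← div_eq_inv_mul, le_div_iff₀ (by positivity)]
  have hgi : Integrable (A.indicator fun _ : Sp N => c) volume :=
    (integrable_indicator_iff hA).2 (integrableOn_const measure_ball_lt_top.ne)
  have hint : ∫ x : Sp N, A.indicator (fun _ => c) x = c * volume.real A := by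
    rw [integral_indicator hA]
    simp [mul_comm]
  rw [← hint, ← integral_prod_mul]
  refine integral_mono_ae ((integrable_sq u.1).mul_prod hgi) u.2.1 ?_
  have h1 : ∀ᵐ z : Sp N × Sp N, z.1 ∉ Ω → u.1 z.1 = 0 :=
    Measure.quasiMeasurePreserving_fst.ae u.2.2
  have h2 : ∀ᵐ z : Sp N × Sp N, z.2 ∉ Ω → u.1 z.2 = 0 :=
    Measure.quasiMeasurePreserving_snd.ae u.2.2
  filter_upwards [h1, h2] with z hz1 hz2
  have h0 := hK.integrand_nonneg u.1 z
  by_cases hx : z.1 ∈ Ω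
  swap
  · simpa [hz1 hx] using h0
  by_cases hy : z.2 ∈ A
  swap
  · simpa [hy] using h0
  have hxR := hR _ hx
  have hyp : ‖z.2 - p‖ < 1 := by simpa [A, dist_eq_norm] using hy
  have hy1 : R < ‖z.2‖ := by
    have := norm_sub_norm_le p z.2
    rw [norm_sub_rev] at this
    linarith
  have hyΩ : z.2 ∉ Ω := fun h => (hR _ h).not_gt hy1
  have hne : z.1 - z.2 ≠ 0 := by
    intro h
    rw [sub_eq_zero] at h
    exact hyΩ (h ▸ hx)
  have hdist : ‖z.1 - z.2‖ ≤ D := by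
    have h3 := norm_sub_le z.1 z.2
    have h4 := norm_sub_norm_le z.2 p
    simp only [D]
    linarith
  have hKc : c ≤ K (z.1 - z.2) := by
    refine le_trans ?_ (hlow _ hne)
    have := Real.rpow_le_rpow_of_nonpos (norm_pos_iff.2 hne) hdist
      (by have : (0:ℝ) ≤ N := N.cast_nonneg
          linarith : -((N : ℝ) + 2 * s) ≤ 0)
    exact mul_le_mul_of_nonneg_left this hα.le
  simp only [Set.indicator_of_mem hy, integrand, hz2 hyΩ, sub_zero]
  rw [← sq]
  exact mul_le_mul_of_nonneg_left hKc (sq_nonneg _)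

/-! ### Bounds for the weighted form -/

theorem Weight.ae_abs_le (ρ : Weight Ω) : ∀ᵐ x ∂(volume.restrict Ω), |ρ x| ≤ ‖ρ‖ := by
  filter_upwards [ae_le_eLpNormEssSup (f := ρ) (μ := volume.restrict Ω)] with x hx
  rw [← eLpNorm_exponent_top] at hx
  have := ENNReal.toReal_mono (Lp.eLpNorm_ne_top ρ) hx
  simpa [Lp.norm_def] using this

theorem Weight.integrable_mul (ρ : Weight Ω) {g : Sp N → ℝ}
    (hg : Integrable g (volume.restrict Ω)) :
    Integrable (fun x => ρ x * g x) (volume.restrict Ω) :=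
  hg.bdd_mul (Lp.aestronglyMeasurable ρ) ρ.ae_abs_le

theorem integrable_quad (ρ : Weight Ω) (u : Lp ℝ 2 (volume : Measure (Sp N))) :
    Integrable (fun x => ρ x * u x ^ 2) (volume.restrict Ω) :=
  ρ.integrable_mul (integrable_sq u).restrict

theorem quad_neg (ρ : Weight Ω) (u : Sp N → ℝ) : quad (-ρ) u = -quad ρ u := by
  rw [quad, quad, ← integral_neg]
  refine integral_congr_ae ?_
  filter_upwards [Lp.coeFn_neg ρ] with x hx
  rw [hx, Pi.neg_apply, neg_mul]

theorem quad_sub (ρ σ : Weight Ω) (u : Lp ℝ 2 (volume : Measure (Sp N))) :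
    quad (ρ - σ) u = quad ρ u - quad σ u := by
  rw [quad, quad, quad, ← integral_sub (integrable_quad ρ u) (integrable_quad σ u)]
  refine integral_congr_ae ?_
  filter_upwards [Lp.coeFn_sub ρ σ] with x hx
  rw [hx, Pi.sub_apply, sub_mul]

theorem abs_quad_le (ρ : Weight Ω) (u : Lp ℝ 2 (volume : Measure (Sp N))) :
    |quad ρ u| ≤ ‖ρ‖ * ∫ x, u x ^ 2 := by
  refine (abs_integral_le_integral_abs).trans ?_
  calc ∫ x in Ω, |ρ x * u x ^ 2| ≤ ∫ x in Ω, ‖ρ‖ * u x ^ 2 := by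
        refine integral_mono_ae (integrable_quad ρ u).abs
          ((integrable_sq u).restrict.const_mul _) ?_
        filter_upwards [ρ.ae_abs_le] with x hx
        simp only [abs_mul, abs_pow, sq_abs]
        gcongr
    _ = ‖ρ‖ * ∫ x in Ω, u x ^ 2 := integral_const_mul _ _
    _ ≤ ‖ρ‖ * ∫ x, u x ^ 2 := by
        gcongr
        exacts [Eventually.of_forall fun x => sq_nonneg _, integrable_sq u, Measure.restrict_le_self]

theorem exists_abs_quad_le_norm (hK : IsKernel N K) (hΩb : Bornology.IsBounded Ω) :
    ∃ C : ℝ, 0 < C ∧ ∀ (ρ : Weight Ω) (u : XK hK Ω), gnorm K u.1 = 1 →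
      |quad ρ u.1| ≤ C * ‖ρ‖ := by
  obtain ⟨C, hC, h⟩ := exists_integral_sq_le_form hK hΩb
  refine ⟨C, hC, fun ρ u hu => (abs_quad_le ρ u.1).trans ?_⟩
  have := h u
  rw [form_eq_one_of_gnorm hu, mul_one] at this
  rw [mul_comm C]
  gcongr

/-! ### Unit vectors of the energy norm -/

theorem form_smul (c : ℝ) (u : Sp N → ℝ) : form K (c • u) (c • u) = c ^ 2 * form K u u := by
  rw [form, form, ← integral_const_mul]
  congr 1
  ext z
  simp only [integrand, Pi.smul_apply, smul_eq_mul]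
  ring

/-- By the Poincaré inequality, zero energy forces zero `L²` norm. Hence every nonzero vector can be
normalized. -/
theorem form_pos (hK : IsKernel N K) (hΩb : Bornology.IsBounded Ω) {u : XK hK Ω} (hu : u ≠ 0) :
    0 < form K u.1 u.1 := by
  obtain ⟨C, hC, h⟩ := exists_integral_sq_le_form hK hΩb
  refine (form_self_nonneg hK _).lt_of_ne fun h0 => hu ?_
  have h1 := h u
  rw [← h0, mul_zero] at h1
  have h2 : (fun x => u.1 x ^ 2) =ᵐ[volume] 0 :=
    (integral_eq_zero_iff_of_nonneg (fun x => sq_nonneg _) (integrable_sq u.1)).1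
      (le_antisymm h1 (integral_nonneg fun x => sq_nonneg _))
  refine Subtype.ext (Lp.ext ?_)
  filter_upwards [h2, Lp.coeFn_zero ℝ 2 (volume : Measure (Sp N))] with x hx hx0
  simpa [hx0] using hx

theorem nonempty_unitVec (hK : IsKernel N K) (hΩb : Bornology.IsBounded Ω)
    {F : Submodule ℝ (XK hK Ω)} (hF : F ≠ ⊥) : Nonempty (UnitVec F) := by
  obtain ⟨u, huF, hu⟩ := F.exists_mem_ne_zero_of_ne_bot hF
  have hpos := form_pos hK hΩb hu
  refine ⟨⟨(√(form K u.1 u.1))⁻¹ • u, F.smul_mem _ huF, ?_⟩⟩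
  have : form K (((√(form K u.1 u.1))⁻¹ • u : XK hK Ω).1 : Sp N → ℝ) ((√(form K u.1 u.1))⁻¹ • u : XK hK Ω).1 = 1 := by
    rw [Submodule.coe_smul, form_congr (Lp.coeFn_smul _ _), form_smul, inv_pow,
      Real.sq_sqrt hpos.le, inv_mul_cancel₀ hpos.ne']
  rw [gnorm, this, Real.sqrt_one]

theorem Sub.ne_bot {hK : IsKernel N K} {k : ℕ} (hk : 0 < k) (F : Sub hK Ω k) : F.1 ≠ ⊥ := by
  intro h
  have := F.2
  rw [h, finrank_bot] at this
  omega

/-! ### Lipschitz dependence of the reciprocal eigenvalues -/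

/-- The inner infimum in the variational formula is Lipschitz in the weight. -/
theorem exists_abs_iInf_quad_sub_le (hK : IsKernel N K) (hΩb : Bornology.IsBounded Ω) :
    ∃ C : ℝ, 0 < C ∧ ∀ (ρ : Weight Ω) (F : Submodule ℝ (XK hK Ω)), F ≠ ⊥ →
      BddBelow (Set.range fun u : UnitVec F => quad ρ u.1.1) ∧
      (⨅ u : UnitVec F, quad ρ u.1.1) ≤ C * ‖ρ‖ ∧
      ∀ σ : Weight Ω, (⨅ u : UnitVec F, quad ρ u.1.1) ≤
        (⨅ u : UnitVec F, quad σ u.1.1) + C * ‖ρ - σ‖ := by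
  obtain ⟨C, hC, h⟩ := exists_abs_quad_le_norm hK hΩb
  have hb : ∀ (ρ : Weight Ω) (F : Submodule ℝ (XK hK Ω)),
      BddBelow (Set.range fun u : UnitVec F => quad ρ u.1.1) := by
    rintro ρ F
    refine ⟨-(C * ‖ρ‖), ?_⟩
    rintro _ ⟨u, rfl⟩
    exact (abs_le.1 (h ρ u.1 u.2.2)).1
  refine ⟨C, hC, fun ρ F hF => ?_⟩
  have := nonempty_unitVec hK hΩb hF
  refine ⟨hb ρ F, ?_, fun σ => ?_⟩
  · obtain ⟨u⟩ := this
    exact (ciInf_le (hb ρ F) u).trans (abs_le.1 (h ρ u.1 u.2.2)).2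
  · rw [← sub_le_iff_le_add]
    refine le_ciInf fun u => ?_
    have h1 := ciInf_le (hb ρ F) u
    have h2 := (abs_le.1 (h (ρ - σ) u.1 u.2.2)).2
    rw [quad_sub] at h2
    linarith

theorem invEigenvalue_of_pos (hK : IsKernel N K) {k : ℤ} (hk : 0 < k) (ρ : Weight Ω) :
    invEigenvalue hK k ρ = ⨆ F : Sub hK Ω k.natAbs, ⨅ u : UnitVec F.1, quad ρ u.1.1 :=
  if_pos hk

theorem bddAbove_iInf_quad (hK : IsKernel N K) (hΩb : Bornology.IsBounded Ω) {k : ℕ}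
    (hk : 0 < k) (ρ : Weight Ω) :
    BddAbove (Set.range fun F : Sub hK Ω k => ⨅ u : UnitVec F.1, quad ρ u.1.1) := by
  obtain ⟨C, -, h⟩ := exists_abs_iInf_quad_sub_le hK hΩb
  refine ⟨C * ‖ρ‖, ?_⟩
  rintro _ ⟨F, rfl⟩
  exact (h ρ F.1 (Sub.ne_bot hk F)).2.1

/-- `λ_k⁻¹` is Lipschitz in the weight for `k > 0`. -/
theorem continuous_invEigenvalue_of_pos (hK : IsKernel N K) (hΩb : Bornology.IsBounded Ω) {k : ℤ}
    (hk : 0 < k) [Nonempty (Sub hK Ω k.natAbs)] :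
    Continuous (fun ρ : Weight Ω => invEigenvalue hK k ρ) := by
  obtain ⟨C, hC, h⟩ := exists_abs_iInf_quad_sub_le hK hΩb
  have hk' : 0 < k.natAbs := Int.natAbs_pos.2 hk.ne'
  refine (LipschitzWith.of_le_add_mul (Real.toNNReal C) fun ρ σ => ?_).continuous
  rw [invEigenvalue_of_pos hK hk, invEigenvalue_of_pos hK hk, Real.coe_toNNReal _ hC.le,
    dist_eq_norm]
  refine ciSup_le fun F => ((h ρ F.1 (Sub.ne_bot hk' F)).2.2 σ).trans ?_
  gcongr
  exact le_ciSup (bddAbove_iInf_quad hK hΩb hk' σ) F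

/-! ### Reduction of negative indices to positive ones -/

theorem invEigenvalue_neg (hK : IsKernel N K) {k : ℤ} (hk : 0 < k) (ρ : Weight Ω) :
    invEigenvalue hK (-k) ρ = -invEigenvalue hK k (-ρ) := by
  rw [invEigenvalue_of_pos hK hk, invEigenvalue, if_neg (by omega), Int.natAbs_neg]
  -- No boundedness or nonemptiness is needed: the real infimum is defined as minus the supremum of
  -- the negated set, so default values agree too.
  have key : ∀ {ι : Type} (f : ι → ℝ), (⨅ i, f i) = -⨆ i, -f i := by
    intro ι f
    rw [iInf, Real.sInf_def, iSup]
    congr 2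
    ext x
    simp [neg_eq_iff_eq_neg]
  rw [key]
  congr 2
  ext F
  rw [key]
  simp [quad_neg]

theorem admissible_neg {k : ℤ} {ρ : Weight Ω} : Admissible (-k) ρ ↔ Admissible k (-ρ) := by
  have h : ∀ᵐ x ∂(volume.restrict Ω), (-ρ : Weight Ω) x = -ρ x := Lp.coeFn_neg ρ
  have h1 : (∀ᵐ x ∂(volume.restrict Ω), ((-ρ : Weight Ω) x)⁺ = 0) ↔
      ∀ᵐ x ∂(volume.restrict Ω), (ρ x)⁻ = 0 :=
    eventually_congr (h.mono fun x hx => by rw [hx, posPart_neg])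
  have h2 : (∀ᵐ x ∂(volume.restrict Ω), ((-ρ : Weight Ω) x)⁻ = 0) ↔
      ∀ᵐ x ∂(volume.restrict Ω), (ρ x)⁺ = 0 :=
    eventually_congr (h.mono fun x hx => by rw [hx, negPart_neg])
  rw [Admissible, Admissible, h1, h2, neg_pos, neg_lt_zero, or_comm]

/-! ### Test functions of finite energy -/

/-- The measure-preserving map `(x, y) ↦ (y, x - y)` turns the integrand into a product of two
integrable functions of separate variables. -/
theorem integrable_indicator_mul_comp_sub {S : Set (Sp N)} (hS : MeasurableSet S)
    (hSfin : volume S ≠ ∞) {g : Sp N → ℝ} (hg : Integrable g volume) :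
    Integrable (fun z : Sp N × Sp N => S.indicator (fun _ => (1 : ℝ)) z.2 * g (z.1 - z.2))
      volume := by
  have h1 : Integrable (S.indicator fun _ : Sp N => (1 : ℝ)) volume :=
    (integrable_indicator_iff hS).2 (integrableOn_const hSfin)
  exact (measurePreserving_prod_sub_swap (volume : Measure (Sp N)) volume).integrable_comp_of_integrable
    (h1.mul_prod hg)

/-- Lipschitz functions with values in `[0, 1]` that vanish outside a set of finite measure have
finite energy. -/
theorem integrable_integrand_of_lipschitz (hK : IsKernel N K) {S : Set (Sp N)}
    (hS : MeasurableSet S) (hSfin : volume S ≠ ∞) {v : Sp N → ℝ} {L : NNReal}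
    (hv : LipschitzWith L v) (hv0 : ∀ x, 0 ≤ v x) (hv1 : ∀ x, v x ≤ 1)
    (hvS : ∀ x, x ∉ S → v x = 0) : Integrable (integrand K v v) volume := by
  set g : Sp N → ℝ := fun x => min (‖x‖ ^ 2) 1 * K x
  set χ : Sp N → ℝ := S.indicator fun _ => (1 : ℝ)
  have h2 := integrable_indicator_mul_comp_sub hS hSfin hK.integrable
  have h1 : Integrable (fun z : Sp N × Sp N => χ z.1 * g (z.2 - z.1)) volume := h2.swap
  -- The square `(v(x) - v(y))²` is at most both `L² ‖x - y‖²` and `1`, and it vanishes when both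
  -- points lie outside `S`; the factor `χ(x) + χ(y)` records the latter.
  refine ((h1.add h2).const_mul ((L : ℝ) ^ 2 + 1)).mono'
    (hK.aestronglyMeasurable_integrand hv.continuous.aestronglyMeasurable) ?_
  refine Eventually.of_forall fun z => ?_
  rw [Real.norm_of_nonneg (hK.integrand_nonneg _ z)]
  rcases eq_or_ne z.1 z.2 with h | h
  · simp [integrand, h, g]
  have hne : z.1 - z.2 ≠ 0 := sub_ne_zero.2 h
  have hKpos := hK.pos _ hne
  have hsymm : g (z.2 - z.1) = g (z.1 - z.2) := by
    simp only [g]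
    rw [← neg_sub z.1 z.2, norm_neg, hK.symm _ hne]
  have hχ0 : ∀ x, 0 ≤ χ x := Set.indicator_nonneg fun _ _ => zero_le_one
  have hm : 0 ≤ min (‖z.1 - z.2‖ ^ 2) 1 := by positivity
  simp only [Pi.add_apply]
  change _ ≤ ((L : ℝ) ^ 2 + 1) * (χ z.1 * g (z.2 - z.1) + χ z.2 * g (z.1 - z.2))
  rw [hsymm, ← add_mul]
  simp only [g, integrand]
  rw [← mul_assoc, ← mul_assoc]
  refine mul_le_mul_of_nonneg_right ?_ hKpos.le
  have hLip : |v z.1 - v z.2| ≤ L * ‖z.1 - z.2‖ := by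
    simpa [Real.dist_eq, dist_eq_norm] using hv.dist_le_mul z.1 z.2
  have hle1 : |v z.1 - v z.2| ≤ 1 := by
    rw [abs_le]
    constructor <;> linarith [hv0 z.1, hv0 z.2, hv1 z.1, hv1 z.2]
  have hbound : (v z.1 - v z.2) * (v z.1 - v z.2) ≤
      ((L : ℝ) ^ 2 + 1) * min (‖z.1 - z.2‖ ^ 2) 1 := by
    rw [← sq, ← sq_abs]
    rcases min_choice (‖z.1 - z.2‖ ^ 2) 1 with hmin | hmin <;> rw [hmin]
    · nlinarith [pow_le_pow_left₀ (abs_nonneg _) hLip 2, sq_nonneg ‖z.1 - z.2‖]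
    · nlinarith [pow_le_pow_left₀ (abs_nonneg _) hle1 2, sq_nonneg (L : ℝ)]
  by_cases hz : z.1 ∈ S ∨ z.2 ∈ S
  · have hχ1 : 1 ≤ χ z.1 + χ z.2 := by
      rcases hz with hz | hz
      · have : χ z.1 = 1 := Set.indicator_of_mem hz _
        linarith [hχ0 z.2]
      · have : χ z.2 = 1 := Set.indicator_of_mem hz _
        linarith [hχ0 z.1]
    refine hbound.trans ?_
    rw [mul_right_comm]
    exact le_mul_of_one_le_right (by positivity) hχ1
  · push Not at hz
    rw [hvS _ hz.1, hvS _ hz.2]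
    have := hχ0 z.1
    have := hχ0 z.2
    simp only [sub_zero, mul_zero]
    positivity

/-- The tent function of slope `n` around `Q`. -/
noncomputable def tent (Q : Set (Sp N)) (n : ℕ) (x : Sp N) : ℝ :=
  max 0 (1 - n * Metric.infDist x Q)

theorem tent_nonneg (Q : Set (Sp N)) (n : ℕ) (x : Sp N) : 0 ≤ tent Q n x := le_max_left _ _

theorem tent_le_one (Q : Set (Sp N)) (n : ℕ) (x : Sp N) : tent Q n x ≤ 1 := by
  have : 0 ≤ n * Metric.infDist x Q := mul_nonneg n.cast_nonneg Metric.infDist_nonneg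
  exact max_le zero_le_one (by linarith)

theorem lipschitzWith_tent (Q : Set (Sp N)) (n : ℕ) : LipschitzWith n (tent Q n) := by
  refine LipschitzWith.const_max (LipschitzWith.of_dist_le_mul fun x y => ?_) 0
  have := (Metric.lipschitz_infDist_pt Q).dist_le_mul x y
  rw [Real.dist_eq] at this ⊢
  rw [sub_sub_sub_cancel_left, ← mul_sub, abs_mul, abs_sub_comm]
  simpa using mul_le_mul_of_nonneg_left this (n.cast_nonneg : (0 : ℝ) ≤ n)

theorem tent_eq_zero {Q : Set (Sp N)} {n : ℕ} {x : Sp N} (h : 1 ≤ n * Metric.infDist x Q) :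
    tent Q n x = 0 :=
  max_eq_left (by linarith)

theorem eventually_le_natCast_mul {δ : ℝ} (hδ : 0 < δ) : ∀ᶠ n : ℕ in atTop, 1 ≤ n * δ :=
  (tendsto_natCast_atTop_atTop.atTop_mul_const hδ).eventually_ge_atTop 1

theorem tendsto_tent {Q : Set (Sp N)} (hQ : IsClosed Q) (hne : Q.Nonempty) (x : Sp N) :
    Tendsto (fun n => tent Q n x) atTop (𝓝 (Q.indicator (fun _ => 1) x)) := by
  by_cases hx : x ∈ Q
  · simp [tent, Metric.infDist_zero_of_mem hx, hx]
  · rw [Set.indicator_of_notMem hx]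
    refine tendsto_const_nhds.congr' ?_
    filter_upwards [eventually_le_natCast_mul ((hQ.notMem_iff_infDist_pos hne).1 hx)] with n hn
    exact (tent_eq_zero hn).symm

/-- Near every portion of `{ρ > 0}` of positive measure there is an element of `X_K(Ω)` on which
the weighted form is positive. -/
theorem exists_mem_XK_quad_pos (hK : IsKernel N K) (hΩb : Bornology.IsBounded Ω) (ρ : Weight Ω)
    {U : Set (Sp N)} (hU : IsOpen U) (hUΩ : U ⊆ Ω) (h : volume ({x | 0 < ρ x} ∩ U) ≠ 0) :
    ∃ v : XK hK Ω, (∀ᵐ x : Sp N, x ∉ U → v.1 x = 0) ∧ 0 < quad ρ v.1 := by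
  have hρm : Measurable ρ := (Lp.stronglyMeasurable ρ).measurable
  have hE : MeasurableSet ({x | 0 < ρ x} ∩ U) :=
    (measurableSet_lt measurable_const hρm).inter hU.measurableSet
  obtain ⟨Q, hQE, hQ, hQpos⟩ := hE.exists_lt_isCompact (pos_iff_ne_zero.2 h)
  have hQne : Q.Nonempty := nonempty_of_measure_ne_zero hQpos.ne'
  have hQU : Q ⊆ U := hQE.trans Set.inter_subset_right
  obtain ⟨δ, hδ, hδU⟩ := hQ.exists_thickening_subset_open hU hQU
  have hΩfin : volume Ω ≠ ∞ := hΩb.measure_lt_top.ne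
  have hUfin : volume U ≠ ∞ := measure_ne_top_of_subset hUΩ hΩfin
  have : IsFiniteMeasure (volume.restrict Ω) := ⟨by simpa using hΩfin.lt_top⟩
  have hρint : Integrable ρ (volume.restrict Ω) := by
    simpa using ρ.integrable_mul (integrable_const (1 : ℝ))
  have hlim : Tendsto (fun n => ∫ x in Ω, ρ x * tent Q n x ^ 2) atTop
      (𝓝 (∫ x in Ω, ρ x * Q.indicator (fun _ => 1) x ^ 2)) := by
    refine tendsto_integral_of_dominated_convergence (fun x => |ρ x|) (fun n => ?_) hρint.abs
      (fun n => ?_) ?_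
    · exact (hρm.mul ((lipschitzWith_tent Q n).continuous.measurable.pow_const 2)).aestronglyMeasurable
    · refine Eventually.of_forall fun x => ?_
      rw [Real.norm_eq_abs, abs_mul, abs_of_nonneg (sq_nonneg (tent Q n x))]
      exact mul_le_of_le_one_right (abs_nonneg _)
        (pow_le_one₀ (tent_nonneg Q n x) (tent_le_one Q n x))
    · exact Eventually.of_forall fun x =>
        ((tendsto_tent hQ.isClosed hQne x).pow 2).const_mul (ρ x)
  have hpos : 0 < ∫ x in Ω, ρ x * Q.indicator (fun _ => 1) x ^ 2 := by
    have heq : (fun x => ρ x * Q.indicator (fun _ => (1 : ℝ)) x ^ 2) = Q.indicator ρ := by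
      ext x
      by_cases hx : x ∈ Q <;> simp [hx]
    rw [heq, integral_indicator hQ.measurableSet, Measure.restrict_restrict hQ.measurableSet,
      Set.inter_eq_self_of_subset_left (hQU.trans hUΩ),
      setIntegral_pos_iff_support_of_nonneg_ae]
    · refine hQpos.trans_le (measure_mono fun x hx => ⟨?_, hx⟩)
      exact (hQE hx).1.ne'
    · filter_upwards [ae_restrict_mem hQ.measurableSet] with x hx
      exact (hQE hx).1.le
    · exact hρint.mono_measure (Measure.restrict_mono (hQU.trans hUΩ) le_rfl)
  -- The tents decrease to the indicator of the compact set `Q ⊆ {ρ > 0}`, so a steep one keeps the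
  -- weighted form positive; slope at least `1/δ` also confines it to `U`.
  obtain ⟨n, hn, hnδ⟩ :=
    ((hlim.eventually (lt_mem_nhds hpos)).and (eventually_le_natCast_mul hδ)).exists
  have hzero : ∀ x, x ∉ U → tent Q n x = 0 := by
    intro x hx
    refine tent_eq_zero (hnδ.trans ?_)
    gcongr
    by_contra! hlt
    exact hx (hδU ((Metric.mem_thickening_iff_infDist_lt hQne).2 hlt))
  have hmem : MemLp (tent Q n) 2 volume := by
    have hb : MemLp (tent Q n) 2 (volume.restrict U) := by
      have : IsFiniteMeasure (volume.restrict U) := ⟨by simpa using hUfin.lt_top⟩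
      refine MemLp.of_bound (lipschitzWith_tent Q n).continuous.aestronglyMeasurable 1
        (Eventually.of_forall fun x => ?_)
      rw [Real.norm_of_nonneg (tent_nonneg Q n x)]
      exact tent_le_one Q n x
    rw [← memLp_indicator_iff_restrict hU.measurableSet] at hb
    refine hb.ae_eq (Eventually.of_forall fun x => ?_)
    by_cases hx : x ∈ U <;> simp [hx, hzero]
  have hcoe := hmem.coeFn_toLp
  have hU0 : ∀ᵐ x : Sp N, x ∉ U → (hmem.toLp (tent Q n)) x = 0 := by
    filter_upwards [hcoe] with x hx hxU
    rw [hx, hzero x hxU]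
  refine ⟨⟨hmem.toLp (tent Q n), ?_, hU0.mono fun x hx hxΩ => hx fun hxU => hxΩ (hUΩ hxU)⟩, hU0, ?_⟩
  · exact (integrable_integrand_of_lipschitz hK hU.measurableSet hUfin (lipschitzWith_tent Q n)
      (tent_nonneg Q n) (tent_le_one Q n) hzero).congr (integrand_congr K hcoe).symm
  · refine hn.trans_eq (integral_congr_ae ?_)
    filter_upwards [ae_restrict_of_ae hcoe] with x hx
    rw [hx]

/-! ### Subspaces on which the weighted form is positive -/

/-- A set of positive measure meets arbitrarily many disjoint open sets in positive measure. -/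
theorem exists_disjoint_open_measure_inter_ne_zero {X : Type*} [TopologicalSpace X] [T2Space X]
    [MeasurableSpace X] [OpensMeasurableSpace X] [HereditarilyLindelofSpace X] {μ : Measure X} [NullSingletonClass μ] {E : Set X}
    (hE : μ E ≠ 0) (k : ℕ) :
    ∃ U : Fin k → Set X, (∀ i, IsOpen (U i)) ∧ Pairwise (fun i j => Disjoint (U i) (U j)) ∧
      ∀ i, μ (U i ∩ E) ≠ 0 := by
  set ν := μ.restrict E
  -- The complement of the support is null. A finite support would be null as well, as there are no
  -- atoms, contradicting `μ E ≠ 0`.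
  have hinf : ν.support.Infinite := by
    intro hfin
    have h0 : ν ν.supportᶜ = 0 := Measure.measure_compl_support
    have h1 : ν ν.support = 0 := hfin.measure_zero ν
    refine hE ?_
    rw [← Measure.restrict_apply_univ, ← Set.union_compl_self ν.support]
    exact measure_union_null h1 h0
  let e : Fin k ↪ X :=
    (Fin.valEmbedding.trans hinf.natEmbedding).trans (Function.Embedding.subtype _)
  obtain ⟨V, hV, hdisj⟩ := (Set.finite_range e).t2_separation
  refine ⟨fun i => V (e i), fun i => (hV _).2, fun i j hij => ?_, fun i => ?_⟩
  · exact hdisj ⟨i, rfl⟩ ⟨j, rfl⟩ (e.injective.ne hij)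
  · rw [← Measure.restrict_apply (hV _).2.measurableSet]
    have hmem : e i ∈ ν.support := (hinf.natEmbedding _ i).2
    exact ((Measure.mem_support_iff_forall _).1 hmem _ ((hV _).2.mem_nhds (hV _).1)).ne'

theorem coeFn_sum_smul {hK : IsKernel N K} {ι : Type*} [Fintype ι] (a : ι → ℝ)
    (v : ι → XK hK Ω) :
    ((∑ i, a i • v i : XK hK Ω).1 : Sp N → ℝ) =ᵐ[volume] fun x => ∑ i, a i * (v i).1 x := by
  have h1 : ∀ᵐ x : Sp N, ∀ i, (a i • (v i).1) x = a i * (v i).1 x :=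
    ae_all_iff.2 fun i => Lp.coeFn_smul (a i) (v i).1
  have h2 : ((∑ i, a i • v i : XK hK Ω).1 : Sp N → ℝ) =ᵐ[volume]
      ∑ i, ⇑(a i • (v i).1) := by
    rw [Submodule.coe_sum]
    exact Lp.coeFn_finsetSum _ _
  filter_upwards [h1, h2] with x hx1 hx2
  rw [hx2, Finset.sum_apply]
  exact Finset.sum_congr rfl fun i _ => hx1 i

/-- This is Cauchy–Schwarz under the integral. Disjoint supports do not remove the cross terms of a
nonlocal energy, so a bound replaces an identity. -/
theorem form_sum_smul_le {hK : IsKernel N K} {ι : Type*} [Fintype ι] (a : ι → ℝ)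
    (v : ι → XK hK Ω) :
    form K (∑ i, a i • v i : XK hK Ω).1 (∑ i, a i • v i : XK hK Ω).1 ≤
      Fintype.card ι * ∑ i, a i ^ 2 * form K (v i).1 (v i).1 := by
  have hint : ∀ i, Integrable (fun z => a i ^ 2 * integrand K (v i).1 (v i).1 z) volume :=
    fun i => (v i).2.1.const_mul _
  rw [form_congr (coeFn_sum_smul a v)]
  simp only [form]
  simp_rw [← integral_const_mul]
  rw [← integral_finsetSum _ fun i _ => hint i, ← integral_const_mul]
  refine integral_mono_of_nonneg (Eventually.of_forall fun z => hK.integrand_nonneg _ z)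
    ((integrable_finsetSum _ fun i _ => hint i).const_mul _) (Eventually.of_forall fun z => ?_)
  by_cases hz : z.1 = z.2
  · simp [integrand, hz]
  have hKz := (hK.pos _ (sub_ne_zero.2 hz)).le
  have key := mul_le_mul_of_nonneg_right
    (sq_sum_le_card_mul_sum_sq (s := Finset.univ)
      (f := fun i => a i * ((v i).1 z.1 - (v i).1 z.2))) hKz
  simp only [integrand]
  calc _ = (∑ i, a i * ((v i).1 z.1 - (v i).1 z.2)) ^ 2 * K (z.1 - z.2) := by
        rw [← Finset.sum_sub_distrib, ← sq]
        simp only [mul_sub]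
    _ ≤ _ := key
    _ = _ := by
        rw [Finset.card_univ, mul_assoc, Finset.sum_mul]
        congr 1
        exact Finset.sum_congr rfl fun i _ => by ring

/-- At almost every point at most one `v i` is nonzero, so the cross terms vanish. -/
theorem quad_sum_smul_of_disjoint {hK : IsKernel N K} {ι : Type*} [Fintype ι] (ρ : Weight Ω)
    (a : ι → ℝ) (v : ι → XK hK Ω) {U : ι → Set (Sp N)}
    (hU : Pairwise fun i j => Disjoint (U i) (U j))
    (hv : ∀ i, ∀ᵐ x : Sp N, x ∉ U i → (v i).1 x = 0) :
    quad ρ (∑ i, a i • v i : XK hK Ω).1 = ∑ i, a i ^ 2 * quad ρ (v i).1 := by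
  simp only [quad]
  simp_rw [← integral_const_mul]
  rw [← integral_finsetSum _ fun i _ => (integrable_quad ρ (v i).1).const_mul _]
  refine integral_congr_ae ?_
  filter_upwards [ae_restrict_of_ae (coeFn_sum_smul a v), ae_restrict_of_ae (ae_all_iff.2 hv)]
    with x hx hvx
  rw [hx]
  by_cases h : ∃ i, x ∈ U i
  · obtain ⟨i, hi⟩ := h
    have h0 : ∀ j, j ≠ i → (v j).1 x = 0 := fun j hj =>
      hvx j fun hjU => Set.disjoint_left.1 (hU hj) hjU hi
    rw [Finset.sum_eq_single i (fun j _ hj => by simp [h0 j hj]) (by simp),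
      Finset.sum_eq_single i (fun j _ hj => by simp [h0 j hj]) (by simp)]
    ring
  · push Not at h
    simp [fun i => hvx i (h i)]

/-- If `ρ⁺ ≢ 0`, then the weighted form is positive definite on a subspace of any prescribed
dimension. -/
theorem exists_sub_form_le_quad (hK : IsKernel N K) (hΩ : IsOpen Ω) (hΩb : Bornology.IsBounded Ω)
    (ρ : Weight Ω) (hρ : ¬ ∀ᵐ x ∂(volume.restrict Ω), (ρ x)⁺ = 0) (k : ℕ) :
    ∃ c : ℝ, 0 < c ∧ ∃ F : Sub hK Ω k, ∀ u ∈ F.1, c * form K u.1 u.1 ≤ quad ρ u.1 := by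
  have := hK.nontrivial_sp
  have hE : volume ({x | 0 < ρ x} ∩ Ω) ≠ 0 := by
    rw [← Measure.restrict_apply' hΩ.measurableSet]
    intro h0
    refine hρ ?_
    filter_upwards [measure_eq_zero_iff_ae_notMem.1 h0] with x hx
    exact posPart_eq_zero.2 (not_lt.1 hx)
  obtain ⟨V, hVo, hVd, hV⟩ := exists_disjoint_open_measure_inter_ne_zero hE k
  have hex : ∀ i, ∃ v : XK hK Ω, (∀ᵐ x : Sp N, x ∉ Ω ∩ V i → v.1 x = 0) ∧ 0 < quad ρ v.1 :=
    fun i => exists_mem_XK_quad_pos hK hΩb ρ (hΩ.inter (hVo i)) Set.inter_subset_left (by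
      rw [← Set.inter_assoc, Set.inter_comm]
      exact hV i)
  choose v hv0 hvq using hex
  have hd : Pairwise fun i j => Disjoint (Ω ∩ V i) (Ω ∩ V j) := fun i j hij =>
    (hVd hij).mono Set.inter_subset_right Set.inter_subset_right
  have hquad := fun a : Fin k → ℝ => quad_sum_smul_of_disjoint ρ a v hd hv0
  -- The weighted form is diagonal in the coefficients with positive entries, so it vanishes only at
  -- `a = 0`.
  have hli : LinearIndependent ℝ v := by
    rw [Fintype.linearIndependent_iff]
    intro a ha i
    have h1 := hquad a
    have h2 : quad ρ (0 : XK hK Ω).1 = 0 := by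
      simpa using hquad 0
    rw [ha, h2, eq_comm,
      Finset.sum_eq_zero_iff_of_nonneg fun i _ => mul_nonneg (sq_nonneg _) (hvq i).le] at h1
    simpa [(hvq i).ne'] using h1 i (Finset.mem_univ i)
  -- The sum dominates each ratio of `k` times the energy to the weighted form; the summand `1`
  -- keeps `M` positive even when the sum is zero.
  set M : ℝ := 1 + ∑ i, k * form K (v i).1 (v i).1 / quad ρ (v i).1
  have hterm : ∀ i, 0 ≤ k * form K (v i).1 (v i).1 / quad ρ (v i).1 := fun i =>
    div_nonneg (mul_nonneg k.cast_nonneg (form_self_nonneg hK _)) (hvq i).le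
  have hM : 0 < M := add_pos_of_pos_of_nonneg one_pos (Finset.sum_nonneg fun i _ => hterm i)
  have hMi : ∀ i, k * form K (v i).1 (v i).1 ≤ M * quad ρ (v i).1 := by
    intro i
    rw [← div_le_iff₀ (hvq i)]
    have := Finset.single_le_sum (fun i _ => hterm i) (Finset.mem_univ i)
    simp only [M]
    linarith
  refine ⟨M⁻¹, inv_pos.2 hM, ⟨Submodule.span ℝ (Set.range v), ?_⟩, fun u hu => ?_⟩
  · rw [finrank_span_eq_card hli, Fintype.card_fin]
  · obtain ⟨a, rfl⟩ := (Submodule.mem_span_range_iff_exists_fun ℝ).1 hu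
    rw [inv_mul_le_iff₀ hM, hquad a, Finset.mul_sum]
    refine (form_sum_smul_le a v).trans ?_
    rw [Fintype.card_fin, Finset.mul_sum]
    refine Finset.sum_le_sum fun i _ => ?_
    have := mul_le_mul_of_nonneg_left (hMi i) (sq_nonneg (a i))
    linarith

/-! ### Positivity of the reciprocal, stability of admissibility, continuity -/

/-- The uniform constant `c` bounds the infimum over unit vectors from below, so no compactness of
the unit sphere is invoked. -/
theorem invEigenvalue_pos (hK : IsKernel N K) (hΩ : IsOpen Ω) (hΩb : Bornology.IsBounded Ω)
    {k : ℤ} (hk : 0 < k) (ρ : Weight Ω) (hρ : ¬ ∀ᵐ x ∂(volume.restrict Ω), (ρ x)⁺ = 0) :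
    0 < invEigenvalue hK k ρ := by
  have hk' : 0 < k.natAbs := Int.natAbs_pos.2 hk.ne'
  obtain ⟨c, hc, F, hF⟩ := exists_sub_form_le_quad hK hΩ hΩb ρ hρ k.natAbs
  have := nonempty_unitVec hK hΩb (Sub.ne_bot hk' F)
  rw [invEigenvalue_of_pos hK hk]
  refine hc.trans_le (le_trans ?_ (le_ciSup (bddAbove_iInf_quad hK hΩb hk' ρ) F))
  refine le_ciInf fun u => ?_
  simpa [form_eq_one_of_gnorm u.2.2] using hF u.1 u.2.1

/-- One unit vector with positive weighted form suffices, whatever `k` is: positivity persists for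
nearby weights and is impossible for a nonpositive weight. -/
theorem eventually_admissible_of_pos (hK : IsKernel N K) (hΩ : IsOpen Ω)
    (hΩb : Bornology.IsBounded Ω) {k : ℤ} (hk : 0 < k) {ρ : Weight Ω} (hρ : Admissible k ρ) :
    ∀ᶠ σ in 𝓝 ρ, Admissible k σ := by
  have hρ' : ¬ ∀ᵐ x ∂(volume.restrict Ω), (ρ x)⁺ = 0 := by
    rcases hρ with h | h
    · exact h.2
    · omega
  obtain ⟨c, hc, F, hF⟩ := exists_sub_form_le_quad hK hΩ hΩb ρ hρ' 1
  obtain ⟨u⟩ := nonempty_unitVec hK hΩb (Sub.ne_bot one_pos F)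
  obtain ⟨C, hC, h⟩ := exists_abs_quad_le_norm (Ω := Ω) hK hΩb
  have hq : 0 < quad ρ u.1.1 := by
    have := hF u.1 u.2.1
    rw [form_eq_one_of_gnorm u.2.2] at this
    linarith
  filter_upwards [Metric.ball_mem_nhds ρ (div_pos hq hC)] with σ hσ
  refine Or.inl ⟨hk, fun h0 => ?_⟩
  rw [mem_ball_iff_norm', lt_div_iff₀' hC] at hσ
  have h1 := (abs_le.1 (h (ρ - σ) u.1 u.2.2)).2
  rw [quad_sub] at h1
  have h2 : quad σ u.1.1 ≤ 0 := by
    refine integral_nonpos_of_ae ?_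
    filter_upwards [h0] with x hx
    exact mul_nonpos_of_nonpos_of_nonneg (posPart_eq_zero.1 hx) (sq_nonneg _)
  linarith

theorem continuousAt_eigenvalue_of_pos (hK : IsKernel N K) (hΩ : IsOpen Ω)
    (hΩb : Bornology.IsBounded Ω) {k : ℤ} (hk : 0 < k) {ρ : Weight Ω} (hρ : Admissible k ρ) :
    ContinuousAt (fun σ : Weight Ω => eigenvalue hK k σ) ρ := by
  have hρ' : ¬ ∀ᵐ x ∂(volume.restrict Ω), (ρ x)⁺ = 0 := by
    rcases hρ with h | h
    · exact h.2
    · omega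
  -- Only the existence of a `k`-dimensional subspace is used here, so that the supremum runs over a
  -- nonempty family.
  obtain ⟨-, -, F, -⟩ := exists_sub_form_le_quad hK hΩ hΩb ρ hρ' k.natAbs
  have : Nonempty (Sub hK Ω k.natAbs) := ⟨F⟩
  exact (continuous_invEigenvalue_of_pos hK hΩb hk).continuousAt.inv₀
    (invEigenvalue_pos hK hΩ hΩb hk ρ hρ').ne'

theorem eigenvalue_neg (hK : IsKernel N K) {k : ℤ} (hk : 0 < k) (ρ : Weight Ω) :
    eigenvalue hK (-k) ρ = -eigenvalue hK k (-ρ) := by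
  rw [eigenvalue, invEigenvalue_neg hK hk, inv_neg, eigenvalue]

end Nonlocal

theorem proposition2p2 {N : ℕ} {K : Nonlocal.Sp N → ℝ} (hK : Nonlocal.IsKernel N K)
    {Ω : Set (Nonlocal.Sp N)} (hΩ : IsOpen Ω) (hΩb : Bornology.IsBounded Ω)
    (ρ : Nonlocal.Weight Ω) (ρn : ℕ → Nonlocal.Weight Ω)
    (hρ : Tendsto ρn atTop (𝓝 ρ))
    (k : ℤ) (hk : Nonlocal.Admissible k ρ) :
    (∀ᶠ n in atTop, Nonlocal.Admissible k (ρn n)) ∧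
      Tendsto (fun n => Nonlocal.eigenvalue hK k (ρn n)) atTop
        (𝓝 (Nonlocal.eigenvalue hK k ρ)) := by
  have hk0 : 0 < k ∨ k < 0 := hk.imp And.left And.left
  rcases hk0 with hpos | hneg
  · exact ⟨hρ.eventually (Nonlocal.eventually_admissible_of_pos hK hΩ hΩb hpos hk),
      (Nonlocal.continuousAt_eigenvalue_of_pos hK hΩ hΩb hpos hk).tendsto.comp hρ⟩
  · obtain ⟨m, rfl⟩ : ∃ m, k = -m := ⟨-k, (neg_neg k).symm⟩
    have hm : 0 < m := neg_lt_zero.1 hneg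
    simp only [Nonlocal.admissible_neg, Nonlocal.eigenvalue_neg hK hm] at hk ⊢
    exact ⟨hρ.neg.eventually (Nonlocal.eventually_admissible_of_pos hK hΩ hΩb hm hk),
      ((Nonlocal.continuousAt_eigenvalue_of_pos hK hΩ hΩb hm hk).tendsto.comp hρ.neg).neg⟩
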